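/- Let $1\le B\le N$, let $F\in\mathbb R^{N\times N}$ be a matrix whose rows have Euclidean norm $1$ and whose entries satisfy $\max_{i,j}|F_{ij}|=c/\sqrt B$ with $c>0$, let $\Psi\in\mathbb R^{N\times N}$ be an orthonormal matrix, and let $R$ be a random diagonal $N\times N$ matrix whose diagonal entries are independent and equal to $1$ or $-1$ with probability $1/2$ each. Put $A=FR$. Let $T\subseteq\{1,\dots,N\}$ be a fixed set with $|T|=K$, let $\Psi_T$ be the $N\times K$ matrix formed by the columns of $\Psi$ indexed by $T$, and let $0<\delta<1$. Then, with probability at least $1-\delta$, the cumulative coherence $$\mu_c(A,\Psi_T)=\max_{1\le i\le N}\sqrt{\sum_{j\in T}\langle A_i,\Psi_j\rangle^2}$$ (where $A_i$ are the rows of $A$ and $\Psi_j$ the columns of $\Psi$) satisfies $$\mu_c(A,\Psi_T)\le \frac{2c}{\sqrt B}\,\max\left(\sqrt K,\;4\sqrt{\log(2N/\delta)}\right).$$ -/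

import Mathlib

open MeasureTheory ProbabilityTheory
open scoped Matrix

/-- The local randomizer: a random diagonal `N × N` matrix whose diagonal entries are independent
random signs, each equal to `1` with probability `1/2` and to `-1` with probability `1/2`. -/
structure IsLocalRandomizer {Ω : Type*} [MeasurableSpace Ω] (P : Measure Ω) {N : ℕ}
    (R : Ω → Matrix (Fin N) (Fin N) ℝ) : Prop where
  isDiag : ∀ ω, (R ω).IsDiag
  measurable : ∀ k, Measurable fun ω => R ω k k
  indep : iIndepFun (fun k ω => R ω k k) P
  prob_one : ∀ k, P {ω | R ω k k = 1} = 1 / 2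
  prob_neg_one : ∀ k, P {ω | R ω k k = -1} = 1 / 2

/-- The cumulative coherence `max_i √(∑_j ⟨A_i, B_j⟩²)` of a square matrix `A` with rows `A_i` and
a matrix `B` with columns `B_j`. -/
noncomputable def cumulativeCoherence {N : ℕ} {κ : Type*} [Fintype κ]
    (A : Matrix (Fin N) (Fin N) ℝ) (B : Matrix (Fin N) κ ℝ) : ℝ :=
  ⨆ i : Fin N, √(∑ j : κ, (A.row i ⬝ᵥ B.col j) ^ 2)

/-- The submatrix of `Ψ` formed by the columns whose index lies in `T`. -/
def columnsOn {N : ℕ} (Ψ : Matrix (Fin N) (Fin N) ℝ) (T : Finset (Fin N)) :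
    Matrix (Fin N) T ℝ :=
  Ψ.submatrix id (fun j : T => (j : Fin N))

/-! Put b = c/√B. Row i of F R Ψ_T is b·Y with Y = ∑ₖ εₖ Mₖ, where M is Ψ_T with row k scaled by F i
k / b. These scalings are at most 1 in absolute value and Ψ_T is an isometry, so M is a contraction.

The square in exp(‖Y‖²/4) is linearized as E_g exp⟨Y, g⟩, with g Gaussian of variance 1/2 per
coordinate. For fixed g, independence of the signs gives E_ε exp⟨ε, M g⟩ ≤ exp(‖M g‖²/2) ≤
exp(‖g‖²/2), whose Gaussian mean is √2 ^ K (`lintegral_exp_sum_sq_le`). Markov's inequality turns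
this into a tail bound (`measure_le_sum_sq_le`), and a union bound over the N rows concludes. -/

/-- A random sign is sub-Gaussian with variance proxy `1`. -/
lemma hasSubgaussianMGF_of_random_sign {Ω : Type*} [MeasurableSpace Ω] {P : Measure Ω}
    [IsProbabilityMeasure P] {X : Ω → ℝ} (hX : Measurable X)
    (h1 : P {ω | X ω = 1} = 1 / 2) (h2 : P {ω | X ω = -1} = 1 / 2) :
    HasSubgaussianMGF X 1 P := by
  have m1 : MeasurableSet {ω | X ω = 1} := hX (measurableSet_singleton 1)
  have m2 : MeasurableSet {ω | X ω = -1} := hX (measurableSet_singleton (-1))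
  have hd : Disjoint {ω | X ω = 1} {ω | X ω = -1} := by
    rw [Set.disjoint_left]
    intro ω h h'
    simp only [Set.mem_ofPred_eq] at h h'
    linarith
  have hae : ∀ᵐ ω ∂P, X ω = 1 ∨ X ω = -1 := by
    have hu : P ({ω | X ω = 1} ∪ {ω | X ω = -1}) = 1 := by
      rw [measure_union hd m2, h1, h2, ENNReal.add_halves]
    exact (prob_compl_eq_zero_iff (m1.union m2)).2 hu
  have hmean : ∫ ω, X ω ∂P = 0 := by
    have hind : X =ᵐ[P] fun ω =>
        {ω | X ω = 1}.indicator (fun _ => (1 : ℝ)) ω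
          - {ω | X ω = -1}.indicator (fun _ => (1 : ℝ)) ω := by
      filter_upwards [hae] with ω hω
      rcases hω with h | h <;> simp [Set.indicator, h] <;> norm_num
    rw [integral_congr_ae hind, integral_sub
      ((integrable_const 1).indicator m1) ((integrable_const 1).indicator m2)]
    simp [integral_indicator_const, m1, m2, measureReal_def, h1, h2]
  -- Hoeffding's lemma: the proxy is ((1 - (-1)) / 2)² = 1.
  have h := hasSubgaussianMGF_of_mem_Icc_of_integral_eq_zero (a := -1) (b := 1) hX.aemeasurable
    (by filter_upwards [hae] with ω hω
        rcases hω with h | h <;> rw [h] <;> norm_num) hmean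
  convert h
  ext
  norm_num

lemma lintegral_exp_sum_mul_le {Ω ι : Type*} [Fintype ι] [MeasurableSpace Ω] {P : Measure Ω}
    {X : ι → Ω → ℝ} (hind : iIndepFun X P) (hX : ∀ i, HasSubgaussianMGF (X i) 1 P)
    (a : ι → ℝ) :
    ∫⁻ ω, ENNReal.ofReal (Real.exp (∑ i, a i * X i ω)) ∂P
      ≤ ENNReal.ofReal (Real.exp (∑ i, a i ^ 2 / 2)) := by
  have hind' : iIndepFun (fun i ω => a i * X i ω) P :=
    hind.comp (fun i x => a i * x) (fun i => measurable_const_mul (a i))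
  have hscale : ∀ i, HasSubgaussianMGF (fun ω => a i * X i ω) (Real.toNNReal (a i ^ 2)) P := by
    intro i
    refine ⟨fun t => ?_, fun t => ?_⟩
    · simpa only [mul_assoc] using (hX i).integrable_exp_mul (t * a i)
    · rw [mgf_const_mul]
      refine ((hX i).mgf_le _).trans_eq ?_
      rw [Real.coe_toNNReal _ (sq_nonneg _), NNReal.coe_one, one_mul, mul_pow]
  have h := HasSubgaussianMGF.sum_of_iIndepFun hind' (s := Finset.univ) fun i _ => hscale i
  have hint := h.integrable_exp_mul 1
  have hle := h.mgf_le 1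
  simp only [mgf, one_mul] at hint hle
  rw [← ofReal_integral_eq_lintegral_ofReal hint (ae_of_all _ fun ω => (Real.exp_pos _).le)]
  refine ENNReal.ofReal_le_ofReal (hle.trans_eq ?_)
  congr 1
  rw [one_pow, mul_one, NNReal.coe_sum, Finset.sum_div]
  refine Finset.sum_congr rfl fun i _ => ?_
  rw [Real.coe_toNNReal _ (sq_nonneg _)]

lemma integral_exp_sq_div_two_gaussianReal_half :
    ∫ x, Real.exp (x ^ 2 / 2) ∂(gaussianReal 0 (1 / 2)) = √2 := by
  rw [integral_gaussianReal_eq_integral_smul (by norm_num)]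
  have h : ∀ x : ℝ, gaussianPDFReal 0 (1 / 2) x • Real.exp (x ^ 2 / 2)
      = (√Real.pi)⁻¹ * Real.exp (-(1 / 2) * x ^ 2) := by
    intro x
    rw [gaussianPDFReal, smul_eq_mul, mul_assoc, ← Real.exp_add]
    push_cast
    congr 2
    · congr 1
      ring_nf
    · ring
  simp_rw [h]
  rw [integral_const_mul, integral_gaussian, ← Real.sqrt_inv, ← Real.sqrt_mul (by positivity)]
  congr 1
  field_simp

lemma lintegral_exp_sum_sq_div_two_gaussianReal_half {ι : Type*} [Fintype ι] :
    ∫⁻ g : ι → ℝ, ENNReal.ofReal (Real.exp (∑ j, g j ^ 2 / 2))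
        ∂(Measure.pi fun _ => gaussianReal 0 (1 / 2))
      = ENNReal.ofReal (√2 ^ Fintype.card ι) := by
  have hint : Integrable (fun x : ℝ => Real.exp (x ^ 2 / 2)) (gaussianReal 0 (1 / 2)) := by
    -- A non-integrable function would have integral 0 by convention, but the integral is √2.
    by_contra hn
    have h := integral_exp_sq_div_two_gaussianReal_half
    rw [integral_undef hn] at h
    have : 0 < √(2 : ℝ) := by positivity
    linarith
  simp_rw [Real.exp_sum]
  rw [← ofReal_integral_eq_lintegral_ofReal (Integrable.fintype_prod fun _ => hint)
    (ae_of_all _ fun g => by positivity),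
    integral_fintype_prod_eq_pow (fun x : ℝ => Real.exp (x ^ 2 / 2)),
    integral_exp_sq_div_two_gaussianReal_half]

/-- Read from right to left, this trades a quadratic exponent in `y` for a linear one, to which
independence applies. -/
lemma lintegral_exp_sum_mul_gaussianReal_half {ι : Type*} [Fintype ι] (y : ι → ℝ) :
    ∫⁻ g : ι → ℝ, ENNReal.ofReal (Real.exp (∑ j, y j * g j))
        ∂(Measure.pi fun _ => gaussianReal 0 (1 / 2))
      = ENNReal.ofReal (Real.exp (∑ j, y j ^ 2 / 4)) := by
  simp_rw [Real.exp_sum]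
  rw [← ofReal_integral_eq_lintegral_ofReal
    (Integrable.fintype_prod fun j => integrable_exp_mul_gaussianReal (y j))
    (ae_of_all _ fun g => by positivity),
    integral_fintype_prod_eq_prod (fun j (x : ℝ) => Real.exp (y j * x))]
  congr 1
  refine Finset.prod_congr rfl fun j _ => ?_
  have h := congrFun (mgf_fun_id_gaussianReal (μ := 0) (v := 1 / 2)) (y j)
  rw [mgf] at h
  rw [h]
  congr 1
  push_cast
  ring

/-- Exponential moment of the squared norm of a Rademacher sum of vectors (the rows of `M`) whose
matrix has operator norm at most `1`. -/
lemma lintegral_exp_sum_sq_le {Ω ι κ : Type*} [Fintype ι] [Fintype κ] [MeasurableSpace Ω]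
    {P : Measure Ω} [IsProbabilityMeasure P] {X : ι → Ω → ℝ} (hm : ∀ i, Measurable (X i))
    (hind : iIndepFun X P) (hX : ∀ i, HasSubgaussianMGF (X i) 1 P)
    (M : ι → κ → ℝ) (hM : ∀ g : κ → ℝ, ∑ i, (∑ j, g j * M i j) ^ 2 ≤ ∑ j, g j ^ 2) :
    ∫⁻ ω, ENNReal.ofReal (Real.exp (∑ j, (∑ i, M i j * X i ω) ^ 2 / 4)) ∂P
      ≤ ENNReal.ofReal (√2 ^ Fintype.card κ) := by
  simp_rw [← lintegral_exp_sum_mul_gaussianReal_half]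
  -- Tonelli: with `∫⁻` the exchange needs only measurability.
  rw [lintegral_lintegral_swap (by fun_prop), ← lintegral_exp_sum_sq_div_two_gaussianReal_half]
  refine lintegral_mono fun g => ?_
  have hswap : ∀ ω, ∑ j, (∑ i, M i j * X i ω) * g j = ∑ i, (∑ j, g j * M i j) * X i ω := by
    intro ω
    simp_rw [Finset.sum_mul]
    rw [Finset.sum_comm]
    exact Finset.sum_congr rfl fun i _ => Finset.sum_congr rfl fun j _ => by ring
  simp_rw [hswap]
  refine (lintegral_exp_sum_mul_le hind hX _).trans ?_
  refine ENNReal.ofReal_le_ofReal (Real.exp_le_exp.2 ?_)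
  rw [← Finset.sum_div, ← Finset.sum_div]
  exact div_le_div_of_nonneg_right (hM g) two_pos.le

/-- Markov's inequality at level exp m. As √2 ≤ exp (1/2) and the dimension is at most m, the moment
costs at most exp (m/2), half of the exponent. -/
lemma measure_le_sum_sq_le {Ω ι κ : Type*} [Fintype ι] [Fintype κ] [MeasurableSpace Ω]
    {P : Measure Ω} [IsProbabilityMeasure P] {X : ι → Ω → ℝ} (hm : ∀ i, Measurable (X i))
    (hind : iIndepFun X P) (hX : ∀ i, HasSubgaussianMGF (X i) 1 P)
    (M : ι → κ → ℝ) (hM : ∀ g : κ → ℝ, ∑ i, (∑ j, g j * M i j) ^ 2 ≤ ∑ j, g j ^ 2)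
    {m : ℝ} (hm' : (Fintype.card κ : ℝ) ≤ m) :
    P {ω | 4 * m ≤ ∑ j, (∑ i, M i j * X i ω) ^ 2} ≤ ENNReal.ofReal (Real.exp (-(m / 2))) := by
  have hsub : {ω | 4 * m ≤ ∑ j, (∑ i, M i j * X i ω) ^ 2} ⊆
      {ω | ENNReal.ofReal (Real.exp m)
        ≤ ENNReal.ofReal (Real.exp (∑ j, (∑ i, M i j * X i ω) ^ 2 / 4))} := by
    intro ω hω
    refine ENNReal.ofReal_le_ofReal (Real.exp_le_exp.2 ?_)
    rw [← Finset.sum_div]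
    simp only [Set.mem_ofPred_eq] at hω
    linarith
  refine (measure_mono hsub).trans ?_
  refine (meas_ge_le_lintegral_div (by fun_prop)
    (by simpa using Real.exp_pos m) ENNReal.ofReal_ne_top).trans ?_
  refine (ENNReal.div_le_div_right (lintegral_exp_sum_sq_le hm hind hX M hM) _).trans ?_
  rw [← ENNReal.ofReal_div_of_pos (Real.exp_pos m)]
  refine ENNReal.ofReal_le_ofReal ?_
  rw [div_le_iff₀ (Real.exp_pos m), ← Real.exp_add]
  have h2 : √(2 : ℝ) ≤ Real.exp (1 / 2) := by
    rw [Real.exp_half]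
    exact Real.sqrt_le_sqrt (by linarith [Real.add_one_le_exp (1 : ℝ)])
  calc √(2 : ℝ) ^ Fintype.card κ ≤ Real.exp (1 / 2) ^ Fintype.card κ := by gcongr
    _ = Real.exp (Fintype.card κ * (1 / 2)) := by rw [← Real.exp_nat_mul]
    _ ≤ Real.exp (-(m / 2) + m) := Real.exp_le_exp.2 (by linarith)

/-- The columns of an orthogonal matrix indexed by `T` are orthonormal. -/
lemma sum_sq_sum_mul_columnsOn {N : ℕ} {Ψ : Matrix (Fin N) (Fin N) ℝ}
    (hΨ : Ψ ∈ Matrix.orthogonalGroup (Fin N) ℝ) (T : Finset (Fin N)) (g : T → ℝ) :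
    ∑ k, (∑ j, g j * columnsOn Ψ T k j) ^ 2 = ∑ j, g j ^ 2 := by
  have hC : (columnsOn Ψ T)ᵀ * columnsOn Ψ T = 1 := by
    have h : Ψᵀ * Ψ = 1 := (Matrix.mem_orthogonalGroup_iff' (n := Fin N) (R := ℝ)).1 hΨ
    ext i j
    have hij := congrFun (congrFun h i) j
    simp only [Matrix.mul_apply, Matrix.transpose_apply, columnsOn, Matrix.submatrix_apply, id,
      Matrix.one_apply] at hij ⊢
    exact hij.trans (by simp only [Subtype.ext_iff])
  have hv : (columnsOn Ψ T *ᵥ g) ⬝ᵥ (columnsOn Ψ T *ᵥ g) = g ⬝ᵥ g := by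
    rw [Matrix.dotProduct_mulVec, ← Matrix.mulVec_transpose, Matrix.mulVec_mulVec, hC,
      Matrix.one_mulVec]
  simpa [dotProduct, Matrix.mulVec, sq, mul_comm] using hv

theorem theorem4 {Ω : Type*} [MeasurableSpace Ω] (P : Measure Ω) [IsProbabilityMeasure P]
    (N K : ℕ) (B c δ : ℝ) (hB : 1 ≤ B) (hBN : B ≤ N) (hc : 0 < c) (hδ : 0 < δ) (hδ1 : δ < 1)
    (F : Matrix (Fin N) (Fin N) ℝ)
    (hFrow : ∀ i, ∑ j, F i j ^ 2 = 1)
    (hFmax : IsGreatest (Set.range fun p : Fin N × Fin N => |F p.1 p.2|) (c / √B))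
    (Ψ : Matrix (Fin N) (Fin N) ℝ) (hΨ : Ψ ∈ Matrix.orthogonalGroup (Fin N) ℝ)
    (R : Ω → Matrix (Fin N) (Fin N) ℝ) (hR : IsLocalRandomizer P R)
    (T : Finset (Fin N)) (hT : T.card = K) :
    1 - δ ≤ P.real {ω | cumulativeCoherence (F * R ω) (columnsOn Ψ T)
      ≤ 2 * c / √B * max √(K : ℝ) (4 * √(Real.log (2 * N / δ)))} := by
  have hN : (1 : ℝ) ≤ N := hB.trans hBN
  set b : ℝ := c / √B with hb
  have hb0 : 0 < b := by positivity
  set ℓ : ℝ := Real.log (2 * N / δ) with hℓ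
  have hℓ0 : 0 ≤ ℓ := Real.log_nonneg (by rw [le_div_iff₀ hδ]; linarith)
  -- The term K absorbs the moment √2 ^ K; the term 16ℓ pays for the union bound.
  set m : ℝ := max (K : ℝ) (16 * ℓ) with hm
  have hmax : max √(K : ℝ) (4 * √ℓ) = √m := by
    have h4 : 4 * √ℓ = √(16 * ℓ) := by
      rw [Real.sqrt_mul (by norm_num), show (16 : ℝ) = 4 ^ 2 by norm_num,
        Real.sqrt_sq (by norm_num)]
    rw [h4, hm, Monotone.map_max fun _ _ h => Real.sqrt_le_sqrt h]
  have hm0 : 0 ≤ m := (Nat.cast_nonneg K).trans (le_max_left _ _)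
  have hsub := fun k =>
    hasSubgaussianMGF_of_random_sign (hR.measurable k) (hR.prob_one k) (hR.prob_neg_one k)
  let M : Fin N → Fin N → T → ℝ := fun i k j => F i k / b * columnsOn Ψ T k j
  have hM : ∀ i, ∀ g : T → ℝ, ∑ k, (∑ j, g j * M i k j) ^ 2 ≤ ∑ j, g j ^ 2 := by
    intro i g
    rw [← sum_sq_sum_mul_columnsOn hΨ T g]
    refine Finset.sum_le_sum fun k _ => ?_
    have hf : ∑ j, g j * M i k j = F i k / b * ∑ j, g j * columnsOn Ψ T k j := by
      rw [Finset.mul_sum]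
      exact Finset.sum_congr rfl fun j _ => by simp only [M]; ring
    have hF : (F i k / b) ^ 2 ≤ 1 := by
      rw [sq_le_one_iff_abs_le_one, abs_div, abs_of_pos hb0, div_le_one hb0]
      exact hFmax.2 ⟨(i, k), rfl⟩
    rw [hf, mul_pow]
    exact mul_le_of_le_one_left (sq_nonneg _) hF
  let E : Fin N → Set Ω := fun i => {ω | 4 * m ≤ ∑ j, (∑ k, M i k j * R ω k k) ^ 2}
  have hE : ∀ i, P (E i) ≤ ENNReal.ofReal (δ / N) := by
    intro i
    refine (measure_le_sum_sq_le hR.measurable hR.indep hsub (M i) (hM i)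
      (m := m) (by simp [hT, hm])).trans (ENNReal.ofReal_le_ofReal ?_)
    -- There is slack here: m ≥ 16ℓ would even give exp (-8ℓ), while exp (-ℓ) = δ / (2N) suffices.
    have hle : Real.exp (-(m / 2)) ≤ Real.exp (-ℓ) :=
      Real.exp_le_exp.2 (by linarith [le_max_right (K : ℝ) (16 * ℓ)])
    refine hle.trans ?_
    rw [Real.exp_neg, hℓ, Real.exp_log (by positivity), inv_div]
    gcongr
    linarith
  have hU : P (⋃ i, E i) ≤ ENNReal.ofReal δ := by
    refine (measure_iUnion_fintype_le P E).trans ((Finset.sum_le_sum fun i _ => hE i).trans ?_)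
    rw [Finset.sum_const, Finset.card_univ, Fintype.card_fin, nsmul_eq_mul,
      ← ENNReal.ofReal_natCast, ← ENNReal.ofReal_mul (by positivity)]
    exact le_of_eq (by congr 1; field_simp)
  have hUr : P.real (⋃ i, E i) ≤ δ := ENNReal.toReal_le_of_le_ofReal hδ.le hU
  -- Covering the whole space and using subadditivity avoids proving that the coherence event is
  -- measurable.
  have hcover : Set.univ ⊆ {ω | cumulativeCoherence (F * R ω) (columnsOn Ψ T)
      ≤ 2 * c / √B * max √(K : ℝ) (4 * √ℓ)} ∪ ⋃ i, E i := by
    intro ω _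
    by_cases hω : ω ∈ ⋃ i, E i
    · exact Or.inr hω
    refine Or.inl ?_
    simp only [E, Set.mem_iUnion, Set.mem_ofPred_eq, not_exists, not_le] at hω
    have hbound : 2 * c / √B * max √(K : ℝ) (4 * √ℓ) = 2 * b * √m := by
      rw [hmax, hb]; ring
    rw [Set.mem_ofPred_eq, hbound, cumulativeCoherence]
    refine Real.iSup_le (fun i => ?_) (by positivity)
    have hrow : ∀ j, (F * R ω).row i ⬝ᵥ (columnsOn Ψ T).col j = b * ∑ k, M i k j * R ω k k := by
      intro j
      rw [dotProduct, Finset.mul_sum]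
      refine Finset.sum_congr rfl fun k _ => ?_
      have hFR : (F * R ω) i k = F i k * R ω k k := by
        rw [Matrix.mul_apply]
        exact Finset.sum_eq_single k (fun l _ hl => by rw [hR.isDiag ω hl, mul_zero])
          (fun h => absurd (Finset.mem_univ k) h)
      simp only [Matrix.row, Matrix.col, Matrix.transpose_apply, M, hFR]
      field_simp
    simp_rw [hrow, mul_pow]
    rw [← Finset.mul_sum]
    refine Real.sqrt_le_iff.2 ⟨by positivity, ?_⟩
    rw [mul_pow, mul_pow, Real.sq_sqrt hm0]
    calc b ^ 2 * ∑ j, (∑ k, M i k j * R ω k k) ^ 2 ≤ b ^ 2 * (4 * m) := by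
          gcongr
          exact (hω i).le
      _ = 2 ^ 2 * b ^ 2 * m := by ring
  have h1 : 1 ≤ P.real {ω | cumulativeCoherence (F * R ω) (columnsOn Ψ T)
      ≤ 2 * c / √B * max √(K : ℝ) (4 * √ℓ)} + P.real (⋃ i, E i) := by
    rw [← probReal_univ (μ := P)]
    exact (measureReal_mono hcover).trans (measureReal_union_le _ _)
  linarith
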